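/- Conventions. Let $G$ be a totally disconnected, locally compact group and $\operatorname{Aut}(G)$ its group of bicontinuous automorphisms. The scale of $\alpha\in\operatorname{Aut}(G)$ is $s_G(\alpha):=\min_U\,[U:U\cap\alpha^{-1}(U)]$, where $U$ ranges over the compact open subgroups of $G$; a compact open subgroup $U$ at which the minimum is attained is called tidy for $\alpha$. The automorphism $\alpha$ is called tidy if every neighbourhood of the identity contains a compact open subgroup which is tidy for $\alpha$. Given a subgroup $\mathcal H\le\operatorname{Aut}(G)$, a joint tidy subgroup for $\mathcal H$ is a compact open subgroup of $G$ which is tidy for every $\alpha\in\mathcal H$; $\mathcal H$ is called flat if a joint tidy subgroup for $\mathcal H$ exists, and $\mathcal H$ has small joint tidy subgroups if every neighbourhood of the identity contains one. Statement. Let $J$ be an infinite, finitely generated group which is periodic (every element has finite order), let $F$ be a non-trivial finite group, and let $G:=F^J$ with the product topology, $F$ being discrete. Let $\operatorname{Sym}(J)$ be the group of all permutations of the set $J$ and let $\pi\colon\operatorname{Sym}(J)\to\operatorname{Aut}(G)$ be the homomorphism given by $\pi(\sigma)(f)(j):=f(\sigma^{-1}(j))$. Let $H\le\operatorname{Sym}(J)$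 be the group of all left translations $x\mapsto jx$ with $j\in J$, and $\mathcal H:=\pi(H)\le\operatorname{Aut}(G)$. Then: 1. $\mathcal H$ is a finitely generated group; 2. $\mathcal H$ is flat; 3. every $\alpha\in\mathcal H$ is a tidy automorphism of $G$; 4. $G$ is the only joint tidy subgroup for $\mathcal H$; in particular, $\mathcal H$ does not have small joint tidy subgroups. -/

import Mathlib

open Topology

namespace TidyAut

/-- The group of bicontinuous automorphisms of a topological group, with composition as product. -/
instance autGroup (G : Type*) [Group G] [TopologicalSpace G] : Group (G ≃ₜ* G) where
  mul α β := β.trans α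
  one := ContinuousMulEquiv.refl G
  inv α := α.symm
  mul_assoc _ _ _ := rfl
  one_mul _ := rfl
  mul_one _ := rfl
  inv_mul_cancel α := ContinuousMulEquiv.self_trans_symm α

section Tidy

variable {G : Type*} [Group G] [TopologicalSpace G]

/-- `U` is a compact open subgroup. -/
def IsCompactOpen (U : Subgroup G) : Prop :=
  IsCompact (U : Set G) ∧ IsOpen (U : Set G)

/-- The index `[U : U ∩ α⁻¹(U)]`, which is finite (so that the natural number is the actual index)
for every compact open subgroup `U` of a topological group. -/
noncomputable def displacement (α : G ≃ₜ* G) (U : Subgroup G) : ℕ :=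
  (U ⊓ U.comap α.toMulEquiv.toMonoidHom).relIndex U

/-- The scale of `α`: the minimum of `[U : U ∩ α⁻¹(U)]` over the compact open subgroups `U`. -/
noncomputable def scale (α : G ≃ₜ* G) : ℕ :=
  sInf {n : ℕ | ∃ U : Subgroup G, IsCompactOpen U ∧ displacement α U = n}

/-- `U` is tidy for `α`: it is a compact open subgroup at which the minimum is attained. -/
def IsTidyFor (α : G ≃ₜ* G) (U : Subgroup G) : Prop :=
  IsCompactOpen U ∧ displacement α U = scale α

/-- `α` is a tidy automorphism: there are arbitrarily small compact open subgroups tidy for it. -/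
def IsTidyAut (α : G ≃ₜ* G) : Prop :=
  ∀ V ∈ 𝓝 (1 : G), ∃ U : Subgroup G, IsTidyFor α U ∧ (U : Set G) ⊆ V

/-- `U` is a joint tidy subgroup for the group `A` of automorphisms. -/
def IsJointTidy (A : Subgroup (G ≃ₜ* G)) (U : Subgroup G) : Prop :=
  ∀ α ∈ A, IsTidyFor α U

/-- `A` is flat: some compact open subgroup is tidy for each of its elements. -/
def IsFlat (A : Subgroup (G ≃ₜ* G)) : Prop :=
  ∃ U : Subgroup G, IsJointTidy A U

/-- `A` has small joint tidy subgroups. -/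
def HasSmallJointTidy (A : Subgroup (G ≃ₜ* G)) : Prop :=
  ∀ V ∈ 𝓝 (1 : G), ∃ U : Subgroup G, IsJointTidy A U ∧ (U : Set G) ⊆ V

end Tidy

/-- The permutation representation `π(σ)(f)(j) = f(σ⁻¹(j))` of `Sym(J)` on `F^J`. -/
def permRep (J F : Type*) [Group F] [TopologicalSpace F] :
    Equiv.Perm J →* ((J → F) ≃ₜ* (J → F)) where
  toFun σ :=
    { toFun := fun f j => f (σ⁻¹ j)
      invFun := fun f j => f (σ j)
      left_inv := fun f => by ext j; simp
      right_inv := fun f => by ext j; simp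
      map_mul' := fun _ _ => rfl
      continuous_toFun := by fun_prop
      continuous_invFun := by fun_prop }
  map_one' := rfl
  map_mul' _ _ := rfl

/-- The group of all left translations `x ↦ j * x` of `J`, as a subgroup of `Sym(J)`. -/
def leftTranslations (J : Type*) [Group J] : Subgroup (Equiv.Perm J) :=
  (MulAction.toPermHom J J).range

/-- The image under `permRep` of the left translations: the group of automorphisms of `F^J`
induced by the action of `J` on itself. -/
def inducedAut (J F : Type*) [Group J] [Group F] [TopologicalSpace F] :
    Subgroup ((J → F) ≃ₜ* (J → F)) :=
  (leftTranslations J).map (permRep J F)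

end TidyAut

namespace TidyAut

section CompactGroup

variable {G : Type*} [Group G] [TopologicalSpace G]

/-! Since `F^J` is compact, the whole group has displacement 1, so every scale is 1 and tidiness of
a compact open subgroup means being mapped into itself (`isTidyFor_iff`). The subgroups `trivialOn F
S` with `S` finite form a neighbourhood basis of the identity. A single translation has finite
order, so `S` lies in a finite set invariant under it, which gives small tidy subgroups. All
translations together leave no room: as `J` is infinite, some `j` moves `S` off itself, and a
jointly tidy `U` containing `trivialOn F S` also contains `trivialOn F (jS)`; these two generate
everything. -/

theorem isCompactOpen_top [CompactSpace G] : IsCompactOpen (⊤ : Subgroup G) :=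
  ⟨by simpa using isCompact_univ, by simp⟩

theorem displacement_top (α : G ≃ₜ* G) : displacement α (⊤ : Subgroup G) = 1 := by
  simp [displacement]

theorem displacement_eq_one_iff {α : G ≃ₜ* G} {U : Subgroup G} :
    displacement α U = 1 ↔ ∀ x ∈ U, α x ∈ U := by
  rw [displacement, Subgroup.relIndex_eq_one, le_inf_iff]
  exact ⟨fun h x hx => h.2 hx, fun h => ⟨le_rfl, fun x hx => h x hx⟩⟩

/-- Open subgroups of a compact group have finite index; this rules out the default value 0 of
`relIndex`, which would spoil the minimum. -/
theorem displacement_ne_zero [IsTopologicalGroup G] [CompactSpace G] (α : G ≃ₜ* G)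
    {U : Subgroup G} (hU : IsOpen (U : Set G)) : displacement α U ≠ 0 := by
  have hW : IsOpen ((U ⊓ U.comap α.toMulEquiv.toMonoidHom : Subgroup G) : Set G) :=
    hU.inter (hU.preimage α.continuous_toFun)
  have := Subgroup.quotient_finite_of_isOpen _ hW
  have := Subgroup.finiteIndex_of_finite_quotient
    (H := U ⊓ U.comap α.toMulEquiv.toMonoidHom)
  exact Subgroup.FiniteIndex.index_ne_zero

theorem scale_eq_one [IsTopologicalGroup G] [CompactSpace G] (α : G ≃ₜ* G) : scale α = 1 := by
  refine le_antisymm (Nat.sInf_le ⟨⊤, isCompactOpen_top, displacement_top α⟩) ?_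
  refine le_csInf ⟨1, ⊤, isCompactOpen_top, displacement_top α⟩ ?_
  rintro n ⟨U, hU, rfl⟩
  exact Nat.one_le_iff_ne_zero.2 (displacement_ne_zero α hU.2)

/-- In a compact group the tidy subgroups are the compact open subgroups mapped into themselves. -/
theorem isTidyFor_iff [IsTopologicalGroup G] [CompactSpace G] {α : G ≃ₜ* G} {U : Subgroup G} :
    IsTidyFor α U ↔ IsCompactOpen U ∧ ∀ x ∈ U, α x ∈ U := by
  rw [IsTidyFor, scale_eq_one, displacement_eq_one_iff]

theorem isJointTidy_top [IsTopologicalGroup G] [CompactSpace G] (A : Subgroup (G ≃ₜ* G)) :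
    IsJointTidy A ⊤ :=
  fun _ _ => isTidyFor_iff.2 ⟨isCompactOpen_top, fun _ _ => Subgroup.mem_top _⟩

end CompactGroup

section Power

variable {J F : Type*} [Group F]

/-- The subgroup of `F^J` of all families that are trivial on `S`. -/
def trivialOn (F : Type*) [Group F] (S : Set J) : Subgroup (J → F) where
  carrier := {f | ∀ i ∈ S, f i = 1}
  one_mem' _ _ := rfl
  mul_mem' hf hg i hi := by simp [hf i hi, hg i hi]
  inv_mem' hf i hi := by simp [hf i hi]

theorem mem_trivialOn {S : Set J} {f : J → F} : f ∈ trivialOn F S ↔ ∀ i ∈ S, f i = 1 := Iff.rfl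

/-- Each family is its restriction off `S` times its restriction to `S`, and the latter is trivial
on `T`. -/
theorem trivialOn_sup_trivialOn {S T : Set J} (h : Disjoint S T) :
    trivialOn F S ⊔ trivialOn F T = ⊤ := by
  classical
  refine eq_top_iff.2 fun f _ => ?_
  have hf : f = (fun i => if i ∈ S then 1 else f i) * fun i => if i ∈ S then f i else 1 := by
    ext i
    by_cases hi : i ∈ S <;> simp [hi]
  rw [hf]
  refine Subgroup.mul_mem_sup (fun i hi => if_pos hi) fun i hi => if_neg ?_
  exact fun hS => Set.disjoint_left.1 h hS hi

variable [TopologicalSpace F]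

theorem exists_trivialOn_subset {V : Set (J → F)} (hV : V ∈ 𝓝 1) :
    ∃ S : Set J, S.Finite ∧ (trivialOn F S : Set (J → F)) ⊆ V := by
  rw [nhds_pi, Filter.mem_pi] at hV
  obtain ⟨S, hS, t, ht, hV⟩ := hV
  refine ⟨S, hS, fun f hf => hV fun i hi => ?_⟩
  rw [mem_trivialOn.1 hf i hi]
  exact mem_of_mem_nhds (ht i)

theorem isOpen_trivialOn [DiscreteTopology F] {S : Set J} (hS : S.Finite) :
    IsOpen (trivialOn F S : Set (J → F)) :=
  isOpen_set_pi (s := fun _ => {(1 : F)}) hS fun _ _ => isOpen_discrete _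

theorem isCompactOpen_trivialOn [Finite F] [DiscreteTopology F] {S : Set J} (hS : S.Finite) :
    IsCompactOpen (trivialOn F S) :=
  ⟨((trivialOn F S).isClosed_of_isOpen (isOpen_trivialOn hS)).isCompact, isOpen_trivialOn hS⟩

end Power

section Translation

variable {J F : Type*} [Group J] [Group F] [TopologicalSpace F]

theorem mem_inducedAut {α : (J → F) ≃ₜ* (J → F)} :
    α ∈ inducedAut J F ↔ ∃ j : J, permRep J F (MulAction.toPermHom J J j) = α := by
  simp [inducedAut, leftTranslations, Subgroup.mem_map]

theorem permRep_toPermHom_apply (j : J) (f : J → F) (i : J) :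
    permRep J F (MulAction.toPermHom J J j) f i = f (j⁻¹ * i) := rfl

theorem inducedAut_fg (h : Group.FG J) : (inducedAut J F).FG := by
  rw [inducedAut, leftTranslations, MonoidHom.map_range]
  exact (Group.fg_iff_subgroup_fg _).1 (Group.fg_range _)

theorem isTidyAut_of_mem_inducedAut (hper : ∀ x : J, IsOfFinOrder x) [Finite F]
    [DiscreteTopology F] {α : (J → F) ≃ₜ* (J → F)} (hα : α ∈ inducedAut J F) : IsTidyAut α := by
  obtain ⟨j, rfl⟩ := mem_inducedAut.1 hα
  intro V hV
  obtain ⟨S, hS, hSV⟩ := exists_trivialOn_subset hV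
  -- Periodicity keeps `⟨j⟩S`, the `⟨j⟩`-invariant hull of `S`, finite.
  have hZ : (Subgroup.zpowers j : Set J).Finite := (hper j).finite_zpowers
  have hT : (Set.image2 (· * ·) (Subgroup.zpowers j : Set J) S).Finite := hZ.image2 _ hS
  refine ⟨trivialOn F (Set.image2 (· * ·) (Subgroup.zpowers j : Set J) S),
    isTidyFor_iff.2 ⟨isCompactOpen_trivialOn hT, ?_⟩, fun f hf => hSV fun i hi => ?_⟩
  · rintro f hf _ ⟨z, hz, s, hs, rfl⟩
    rw [permRep_toPermHom_apply]
    refine hf _ ⟨j⁻¹ * z, ?_, s, hs, mul_assoc _ _ _⟩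
    exact mul_mem (inv_mem (Subgroup.mem_zpowers j)) hz
  · exact hf i ⟨1, one_mem _, i, hi, one_mul i⟩

theorem exists_disjoint_translate [Infinite J] {S : Set J} (hS : S.Finite) :
    ∃ j : J, Disjoint S ((j * ·) '' S) := by
  -- If `jS` met `S`, then `j` would lie in the finite set `SS⁻¹`.
  obtain ⟨j, hj⟩ := (hS.image2 (fun a b : J => a * b⁻¹) hS).exists_notMem
  refine ⟨j, Set.disjoint_left.2 ?_⟩
  rintro _ ha ⟨b, hb, rfl⟩
  exact hj ⟨_, ha, b, hb, by simp⟩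

theorem eq_top_of_isJointTidy [Infinite J] [Finite F] [DiscreteTopology F]
    {U : Subgroup (J → F)} (hU : IsJointTidy (inducedAut J F) U) : U = ⊤ := by
  have hinv (j : J) := isTidyFor_iff.1 (hU _ (mem_inducedAut.2 ⟨j, rfl⟩))
  obtain ⟨S, hS, hSU⟩ := exists_trivialOn_subset ((hinv 1).1.2.mem_nhds U.one_mem)
  obtain ⟨j, hj⟩ := exists_disjoint_translate hS
  rw [eq_top_iff, ← trivialOn_sup_trivialOn hj]
  refine sup_le hSU fun f hf => ?_
  -- Pulling `f` back by `j` makes it trivial on `S`, hence a member of `U`; invariance of `U` under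
  -- `j` then returns `f`.
  have hg : (fun i => f (j * i)) ∈ U := hSU fun i hi => hf _ ⟨i, hi, rfl⟩
  have h := (hinv j).2 _ hg
  have hfg : permRep J F (MulAction.toPermHom J J j) (fun i => f (j * i)) = f := by
    ext i
    rw [permRep_toPermHom_apply, mul_inv_cancel_left]
  rwa [hfg] at h

theorem not_hasSmallJointTidy [Infinite J] [Finite F] [Nontrivial F] [DiscreteTopology F] :
    ¬ HasSmallJointTidy (inducedAut J F) := by
  intro h
  obtain ⟨U, hU, hUV⟩ := h (trivialOn F {(1 : J)} : Set (J → F))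
    ((isOpen_trivialOn (Set.finite_singleton _)).mem_nhds (one_mem _))
  obtain ⟨x, hx⟩ := exists_ne (1 : F)
  rw [eq_top_of_isJointTidy hU] at hUV
  exact hx (hUV (Subgroup.mem_top fun _ : J => x) 1 rfl)

end Translation

end TidyAut

theorem mainTheorem9 {J : Type*} [Group J] [Infinite J] (hfg : Group.FG J)
    (hper : ∀ x : J, IsOfFinOrder x)
    {F : Type*} [Group F] [Finite F] [Nontrivial F] [TopologicalSpace F] [DiscreteTopology F] :
    (TidyAut.inducedAut J F).FG ∧
    TidyAut.IsFlat (TidyAut.inducedAut J F) ∧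
    (∀ α ∈ TidyAut.inducedAut J F, TidyAut.IsTidyAut α) ∧
    (∀ U : Subgroup (J → F), TidyAut.IsJointTidy (TidyAut.inducedAut J F) U ↔ U = ⊤) ∧
    ¬ TidyAut.HasSmallJointTidy (TidyAut.inducedAut J F) :=
  ⟨TidyAut.inducedAut_fg hfg, ⟨⊤, TidyAut.isJointTidy_top _⟩,
    fun _ hα => TidyAut.isTidyAut_of_mem_inducedAut hper hα,
    fun _ => ⟨TidyAut.eq_top_of_isJointTidy, fun h => h ▸ TidyAut.isJointTidy_top _⟩,
    TidyAut.not_hasSmallJointTidy⟩
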